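/- Let $k\ge 1$ and $\mathbb N=\{0,1,2,\dots\}$. Consider the graph on $\mathbb N^k$ in which $x$ and $y$ are adjacent precisely when $\|x-y\|_\infty=\max_i|x_i-y_i|=1$, and for $A\subseteq\mathbb N^k$ let $$\partial A=\{x\in\mathbb N^k:\ \|x-a\|_\infty\le 1\text{ for some }a\in A\},$$ that is, $A$ together with all its neighbours. Define a well-ordering $\prec_{\mathbb N}$ on $\mathbb N^k$ by recursion on $k$. On $\mathbb N^1$ it is the usual order $0<1<2<\cdots$. For $k>1$ and $u\in\mathbb N^k$ put $M(u)=\max_i u_i$, $i_u=\min\{i: u_i=M(u)\}$, and let $u'\in\mathbb N^{k-1}$ be $u$ with its $i_u$-th entry deleted. Then $u\prec_{\mathbb N} v$ if and only if one of the following holds: - $M(u)<M(v)$; - $M(u)=M(v)$ and $i_v<i_u$; - $M(u)=M(v)$, $i_u=i_v$ and $u'\prec_{\mathbb N}v'$ in $\mathbb N^{k-1}$. A set $I\subseteq\mathbb N^k$ is an initial segment if $v\in I$ and $u\prec_{\mathbb N}v$ imply $u\in I$. Let $I$ be an initial segment in $\mathbb N^k$ and let $A\subseteq\mathbb N^k$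 be finite and nonempty. If $|I|=|A|$, then $|\partial I|\le|\partial A|$. -/

import Mathlib

/-- The graph on `ℕ^k` in which two points are adjacent exactly when their `ℓ_∞`-distance is `1`
(`dist` on `Fin k → ℕ` is the sup metric). -/
def linftyGraph (k : ℕ) : SimpleGraph (Fin k → ℕ) where
  Adj x y := dist x y = 1
  symm := ⟨fun x y h => by rw [dist_comm]; exact h⟩
  loopless := ⟨fun x h => by simp at h⟩

/-- The vertex boundary `∂A`: all points of `ℕ^k` at `ℓ_∞`-distance at most `1` from some point
of `A`. In particular `A ⊆ ∂A`. -/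
def vertexBoundary {k : ℕ} (A : Set (Fin k → ℕ)) : Set (Fin k → ℕ) :=
  {x | ∃ a ∈ A, dist x a ≤ 1}

/-- The largest entry `M(u)` of `u ∈ ℕ^(k+1)`. -/
def maxEntry {k : ℕ} (u : Fin (k + 1) → ℕ) : ℕ :=
  Finset.univ.sup' Finset.univ_nonempty u

theorem exists_eq_maxEntry {k : ℕ} (u : Fin (k + 1) → ℕ) :
    (Finset.univ.filter fun i => u i = maxEntry u).Nonempty := by
  obtain ⟨i, -, hi⟩ := Finset.exists_mem_eq_sup' Finset.univ_nonempty u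
  exact ⟨i, by simp [maxEntry, hi]⟩

/-- The first index `i_u` at which `u` takes its largest entry. -/
def firstMaxIndex {k : ℕ} (u : Fin (k + 1) → ℕ) : Fin (k + 1) :=
  (Finset.univ.filter fun i => u i = maxEntry u).min' (exists_eq_maxEntry u)

/-- The strict order `≺_ℕ` on `ℕ^k`, by recursion on `k`. On `ℕ^1` it is the usual order. For
`k ≥ 2` compare the largest entries; on a tie, the vector whose largest entry first occurs later
is the smaller one; if this ties too, delete that entry from both vectors and compare in
`ℕ^(k-1)`. (On the one-point set `ℕ^0` it is the empty relation.) -/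
def precN : (k : ℕ) → (Fin k → ℕ) → (Fin k → ℕ) → Prop
  | 0, _, _ => False
  | 1, u, v => u 0 < v 0
  | k + 2, u, v =>
      maxEntry u < maxEntry v ∨
        (maxEntry u = maxEntry v ∧
          (firstMaxIndex v < firstMaxIndex u ∨
            (firstMaxIndex u = firstMaxIndex v ∧
              precN (k + 1) ((firstMaxIndex u).removeNth u) ((firstMaxIndex v).removeNth v))))

/-- `I` is an initial segment of `(ℕ^k, ≺_ℕ)`. -/
def IsInitialSegmentN {k : ℕ} (I : Set (Fin k → ℕ)) : Prop :=
  ∀ u v : Fin k → ℕ, v ∈ I → precN k u v → u ∈ I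

/-- `∂A` consists of `A` together with all its neighbours in the graph. -/
theorem mem_vertexBoundary_iff {k : ℕ} (A : Set (Fin k → ℕ)) (x : Fin k → ℕ) :
    x ∈ vertexBoundary A ↔ x ∈ A ∨ ∃ a ∈ A, (linftyGraph k).Adj x a := by
  constructor
  · rintro ⟨a, ha, h⟩
    by_cases hxa : x = a
    · exact Or.inl (hxa ▸ ha)
    · refine Or.inr ⟨a, ha, le_antisymm h ?_⟩
      obtain ⟨i, hi⟩ := Function.ne_iff.mp hxa
      exact (Nat.pairwise_one_le_dist hi).trans (dist_le_pi_dist x a i)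
  · rintro (h | ⟨a, ha, h⟩)
    · exact ⟨x, h, by simp⟩
    · exact ⟨a, ha, le_of_eq h⟩

theorem precN_irrefl : ∀ (k : ℕ) (u : Fin k → ℕ), ¬ precN k u u
  | 0, _ => fun h => h
  | 1, _ => fun h => lt_irrefl _ h
  | k + 2, u => by
      simp only [precN, lt_irrefl, true_and, false_or]
      exact precN_irrefl (k + 1) _

theorem precN_trans : ∀ (k : ℕ) (u v w : Fin k → ℕ), precN k u v → precN k v w → precN k u w
  | 0, _, _, _ => fun h _ => h
  | 1, _, _, _ => fun h h' => lt_trans h h'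
  | k + 2, u, v, w => by
      have ih := precN_trans (k + 1) ((firstMaxIndex u).removeNth u)
        ((firstMaxIndex v).removeNth v) ((firstMaxIndex w).removeNth w)
      simp only [precN]
      rintro (h | ⟨h, h1 | ⟨h1, h2⟩⟩) (h' | ⟨h', h1' | ⟨h1', h2'⟩⟩)
      · exact Or.inl (h.trans h')
      · exact Or.inl (h.trans_eq h')
      · exact Or.inl (h.trans_eq h')
      · exact Or.inl (h.trans_lt h')
      · exact Or.inr ⟨h.trans h', Or.inl (h1'.trans h1)⟩
      · exact Or.inr ⟨h.trans h', Or.inl (h1'.symm.trans_lt h1)⟩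
      · exact Or.inl (h.trans_lt h')
      · exact Or.inr ⟨h.trans h', Or.inl (h1'.trans_eq h1.symm)⟩
      · exact Or.inr ⟨h.trans h', Or.inr ⟨h1.trans h1', ih h2 h2'⟩⟩

theorem apply_firstMaxIndex {k : ℕ} (u : Fin (k + 1) → ℕ) : u (firstMaxIndex u) = maxEntry u :=
  (Finset.mem_filter.mp (Finset.min'_mem _ (exists_eq_maxEntry u))).2

theorem precN_trichotomous : ∀ (k : ℕ) (u v : Fin k → ℕ), precN k u v ∨ u = v ∨ precN k v u
  | 0, u, v => Or.inr (Or.inl (Subsingleton.elim u v))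
  | 1, u, v => by
      rcases lt_trichotomy (u 0) (v 0) with h | h | h
      · exact Or.inl h
      · exact Or.inr (Or.inl (funext fun i => by rw [Subsingleton.elim i 0]; exact h))
      · exact Or.inr (Or.inr h)
  | k + 2, u, v => by
      simp only [precN]
      rcases lt_trichotomy (maxEntry u) (maxEntry v) with h | h | h
      · exact Or.inl (Or.inl h)
      · rcases lt_trichotomy (firstMaxIndex u) (firstMaxIndex v) with h1 | h1 | h1
        · exact Or.inr (Or.inr (Or.inr ⟨h.symm, Or.inl h1⟩))
        · rcases precN_trichotomous (k + 1) ((firstMaxIndex u).removeNth u)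
            ((firstMaxIndex v).removeNth v) with h2 | h2 | h2
          · exact Or.inl (Or.inr ⟨h, Or.inr ⟨h1, h2⟩⟩)
          · refine Or.inr (Or.inl ?_)
            have hv := apply_firstMaxIndex v
            rw [← h, ← apply_firstMaxIndex u, ← h1] at hv
            rw [← h1] at h2
            calc u = (firstMaxIndex u).insertNth (u (firstMaxIndex u))
                  ((firstMaxIndex u).removeNth u) := (Fin.insertNth_self_removeNth _ u).symm
              _ = (firstMaxIndex u).insertNth (v (firstMaxIndex u))
                  ((firstMaxIndex u).removeNth v) := by rw [h2, hv]
              _ = v := Fin.insertNth_self_removeNth _ v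
          · exact Or.inr (Or.inr (Or.inr ⟨h.symm, Or.inr ⟨h1.symm, h2⟩⟩))
        · exact Or.inl (Or.inr ⟨h, Or.inl h1⟩)
      · exact Or.inr (Or.inr (Or.inl h))

/-- Every point has only finitely many predecessors. -/
theorem finite_precN : ∀ (k : ℕ) (v : Fin k → ℕ), {u | precN k u v}.Finite
  | 0, _ => Set.toFinite _
  | 1, v => (Set.finite_Iic v).subset fun u hu i => by
      rw [Subsingleton.elim i 0]; exact le_of_lt hu
  | k + 2, v => (Set.finite_Iic fun _ => maxEntry v).subset fun u hu i => by
      have h1 : u i ≤ maxEntry u := Finset.le_sup' u (Finset.mem_univ i)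
      have h2 : maxEntry u ≤ maxEntry v := by
        rcases hu with h | h
        · exact h.le
        · exact h.1.le
      exact h1.trans h2

/-- `≺_ℕ` is a well-ordering of `ℕ^k`. -/
instance precN_isWellOrder (k : ℕ) : IsWellOrder (Fin k → ℕ) (precN k) where
  trichotomous u v h h' := by
    rcases precN_trichotomous k u v with h1 | h1 | h1
    · exact absurd h1 h
    · exact h1
    · exact absurd h1 h'
  wf := by
    refine Subrelation.wf (r := InvImage (· < ·) fun v => {u | precN k u v}.ncard) ?_
      (InvImage.wf _ wellFounded_lt)
    intro u v huv
    refine Set.ncard_lt_ncard ⟨fun w hw => precN_trans k w u v hw huv, fun h => ?_⟩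
      (finite_precN k v)
    exact precN_irrefl k u (h huv)

/-! In a lower set, a point `x` can lie in the boundary only if its truncated predecessor, with
entries `x i - 1`, lies in the set. So the boundary has at most `∑ cubeWeight` points
(`card_finBoundary_le`), and initial segments are lower sets. It remains to bound `|∂A|` below by
the weight of the initial segment of size `|A|`.

For a lower set the competing quantity is its own weight. Among lower sets of the given size and no
larger weight, take one of least total rank. Induction on dimension makes all its slices initial
segments (`IsRankMinimal.mem_of_precN`). Were it not an initial segment itself, exchanging one
point, or a line of points, would lower the rank without raising the weight
(`IsRankMinimal.isInitialSegmentN`).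

An arbitrary `A` is cut into slices along one coordinate. Each slice of `∂A` contains the boundaries
of the neighbouring slices of `A`, so by induction `|∂A|` is at least the sum of the optimal weights
of the slices, plus one further copy of the largest (`sum_range_add_le`). This is exactly the weight
of the lower set obtained by stacking initial segments of the same sizes in decreasing order, to
which the previous case applies. -/

/-! ### The order: largest entries, deletion of entries, boxes. -/

theorem le_maxEntry {k : ℕ} (u : Fin (k + 1) → ℕ) (i : Fin (k + 1)) : u i ≤ maxEntry u :=
  Finset.le_sup' u (Finset.mem_univ i)

theorem maxEntry_le {k : ℕ} {u : Fin (k + 1) → ℕ} {m : ℕ} (h : ∀ i, u i ≤ m) : maxEntry u ≤ m :=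
  Finset.sup'_le _ _ fun i _ => h i

theorem firstMaxIndex_le {k : ℕ} {u : Fin (k + 1) → ℕ} {i : Fin (k + 1)} (h : u i = maxEntry u) :
    firstMaxIndex u ≤ i :=
  Finset.min'_le _ _ (by simp [h])

theorem maxEntry_removeNth_le {k : ℕ} (u : Fin (k + 2) → ℕ) (i : Fin (k + 2)) :
    maxEntry (i.removeNth u) ≤ maxEntry u :=
  maxEntry_le fun j => le_maxEntry u (i.succAbove j)

theorem maxEntry_removeNth {k : ℕ} {u : Fin (k + 2) → ℕ} {i : Fin (k + 2)}
    (h : firstMaxIndex u ≠ i) : maxEntry (i.removeNth u) = maxEntry u := by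
  refine le_antisymm (maxEntry_removeNth_le u i) ?_
  obtain ⟨p, hp⟩ := Fin.exists_succAbove_eq h
  calc maxEntry u = u (firstMaxIndex u) := (apply_firstMaxIndex u).symm
    _ = i.removeNth u p := by rw [← hp]; rfl
    _ ≤ _ := le_maxEntry _ p

theorem succAbove_firstMaxIndex_removeNth {k : ℕ} {u : Fin (k + 2) → ℕ} {i : Fin (k + 2)}
    (h : firstMaxIndex u ≠ i) :
    i.succAbove (firstMaxIndex (i.removeNth u)) = firstMaxIndex u := by
  obtain ⟨p, hp⟩ := Fin.exists_succAbove_eq h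
  apply le_antisymm
  · rw [← hp, Fin.succAbove_le_succAbove_iff]
    apply firstMaxIndex_le
    rw [maxEntry_removeNth h, ← apply_firstMaxIndex u, ← hp]
    rfl
  · apply firstMaxIndex_le
    rw [← maxEntry_removeNth h, ← apply_firstMaxIndex (i.removeNth u)]
    rfl

/-- The recursion defining `precN` is also valid at `k = 1`. -/
theorem precN_succ {k : ℕ} (u v : Fin (k + 1) → ℕ) :
    precN (k + 1) u v ↔ maxEntry u < maxEntry v ∨ (maxEntry u = maxEntry v ∧
      (firstMaxIndex v < firstMaxIndex u ∨ (firstMaxIndex u = firstMaxIndex v ∧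
        precN k ((firstMaxIndex u).removeNth u) ((firstMaxIndex v).removeNth v)))) := by
  cases k with
  | zero =>
    have hm : ∀ w : Fin 1 → ℕ, maxEntry w = w 0 := fun w => by
      rw [← apply_firstMaxIndex w, Subsingleton.elim (α := Fin 1) (firstMaxIndex w) 0]
    simp [precN, hm]
  | succ k => rfl

theorem precN.maxEntry_le {k : ℕ} {u v : Fin (k + 1) → ℕ} (h : precN (k + 1) u v) :
    maxEntry u ≤ maxEntry v := by
  rcases (precN_succ u v).1 h with h | h
  exacts [h.le, h.1.le]

/-- `≺_ℕ` extends the coordinatewise order. -/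
theorem precN_of_lt : ∀ {k : ℕ} {u v : Fin k → ℕ}, u < v → precN k u v
  | 0, u, v, h => absurd (Subsingleton.elim u v) h.ne
  | k + 1, u, v, h => by
    have hM : maxEntry u ≤ maxEntry v := maxEntry_le fun i => (h.le i).trans (le_maxEntry v i)
    rw [precN_succ]
    rcases hM.lt_or_eq with hM | hM
    · exact Or.inl hM
    refine Or.inr ⟨hM, ?_⟩
    have hv : v (firstMaxIndex u) = maxEntry v := le_antisymm (le_maxEntry _ _) <| by
      rw [← hM, ← apply_firstMaxIndex u]
      exact h.le _
    rcases (firstMaxIndex_le hv).lt_or_eq with hi | hi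
    · exact Or.inl hi
    refine Or.inr ⟨hi.symm, precN_of_lt ?_⟩
    rw [hi]
    refine lt_of_le_of_ne (fun j => h.le _) fun he => h.ne ?_
    rw [← Fin.insertNth_self_removeNth (firstMaxIndex u) u,
      ← Fin.insertNth_self_removeNth (firstMaxIndex u) v, he, hv, ← hM, apply_firstMaxIndex u]

/-- Deleting a common entry preserves `≺_ℕ`. -/
theorem precN.removeNth : ∀ {k : ℕ} {u v : Fin (k + 1) → ℕ} {i : Fin (k + 1)},
    precN (k + 1) u v → u i = v i → precN k (i.removeNth u) (i.removeNth v)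
  | 0, u, v, i, h, hi => by
    rw [Subsingleton.elim (α := Fin 1) i 0] at hi
    exact absurd hi (ne_of_lt h)
  | k + 1, u, v, i, h, hi => by
    rcases (precN_succ u v).1 h with h | ⟨h, h1 | ⟨h1, h2⟩⟩
    · have hne : firstMaxIndex v ≠ i := by
        rintro rfl
        rw [apply_firstMaxIndex v] at hi
        exact absurd (le_maxEntry u (firstMaxIndex v)) (by omega)
      rw [precN_succ]
      exact Or.inl (((maxEntry_removeNth_le u i).trans_lt h).trans_eq (maxEntry_removeNth hne).symm)
    · have hne : firstMaxIndex v ≠ i := by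
        rintro rfl
        rw [apply_firstMaxIndex v, ← h] at hi
        exact absurd (firstMaxIndex_le hi) (not_le.2 h1)
      rw [precN_succ, maxEntry_removeNth hne, ← h]
      rcases (maxEntry_removeNth_le u i).lt_or_eq with h2 | h2
      · exact Or.inl h2
      refine Or.inr ⟨h2, Or.inl ?_⟩
      rw [← Fin.succAbove_lt_succAbove_iff (p := i), succAbove_firstMaxIndex_removeNth hne]
      refine h1.trans_le (firstMaxIndex_le ?_)
      rw [← h2, ← apply_firstMaxIndex (i.removeNth u)]
      rfl
    · by_cases hne : firstMaxIndex u = i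
      · rw [← h1, hne] at h2
        exact h2
      have hne' : firstMaxIndex v ≠ i := h1 ▸ hne
      have hu := succAbove_firstMaxIndex_removeNth hne
      have hv := succAbove_firstMaxIndex_removeNth hne'
      have huv : firstMaxIndex (i.removeNth u) = firstMaxIndex (i.removeNth v) :=
        Fin.succAbove_right_injective (p := i) (by rw [hu, hv, h1])
      rw [precN_succ, maxEntry_removeNth hne, maxEntry_removeNth hne']
      refine Or.inr ⟨h, Or.inr ⟨huv, ?_⟩⟩
      -- Entry `i` is not the one compared first, so the two deletions are swapped: the common
      -- largest entry goes first, and induction handles the other.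
      rw [← huv, Fin.removeNth_removeNth_eq_swap, Fin.removeNth_removeNth_eq_swap v, hu]
      rw [← h1] at h2
      refine h2.removeNth ?_
      have := Fin.succAbove_succAbove_predAbove i (firstMaxIndex (i.removeNth u))
      rw [hu] at this
      simp only [Fin.removeNth, this, hi]

theorem precN_insertNth_iff {k : ℕ} (i : Fin (k + 1)) (t : ℕ) (u v : Fin k → ℕ) :
    precN (k + 1) (i.insertNth t u) (i.insertNth t v) ↔ precN k u v := by
  have key : ∀ u v : Fin k → ℕ,
      precN (k + 1) (i.insertNth t u) (i.insertNth t v) → precN k u v := fun u v h => by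
    simpa using h.removeNth (i := i) (by simp)
  refine ⟨key u v, fun h => ?_⟩
  rcases precN_trichotomous (k + 1) (i.insertNth t u) (i.insertNth t v) with h1 | h1 | h1
  · exact h1
  · rw [show u = v by simpa using congrArg i.removeNth h1] at h
    exact absurd h (precN_irrefl _ _)
  · exact absurd (precN_trans _ _ _ _ h (key _ _ h1)) (precN_irrefl _ _)

/-- The points preceding `M • e_i` in `≺_ℕ` form a box. -/
def InBox {k : ℕ} (i : Fin (k + 1)) (M : ℕ) (z : Fin (k + 1) → ℕ) : Prop :=
  (∀ m, z m ≤ M) ∧ ∀ m ≤ i, z m < M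

theorem InBox.mono {k : ℕ} {i : Fin (k + 1)} {M : ℕ} {u z : Fin (k + 1) → ℕ} (hz : InBox i M z)
    (h : u ≤ z) : InBox i M u :=
  ⟨fun m => (h m).trans (hz.1 m), fun m hm => (h m).trans_lt (hz.2 m hm)⟩

theorem InBox.precN {k : ℕ} {i : Fin (k + 1)} {M : ℕ} {z v : Fin (k + 1) → ℕ} (hz : InBox i M z)
    (hv : M ≤ v i) : precN (k + 1) z v := by
  have h1 : maxEntry z ≤ M := _root_.maxEntry_le hz.1
  have h2 := le_maxEntry v i
  rw [precN_succ]
  rcases (h1.trans (hv.trans h2)).lt_or_eq with h | h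
  · exact Or.inl h
  refine Or.inr ⟨h, Or.inl ((firstMaxIndex_le (i := i) (by omega)).trans_lt (lt_of_not_ge fun hi => ?_))⟩
  have h3 := hz.2 _ hi
  rw [apply_firstMaxIndex z] at h3
  omega

/-- If `y` attains the largest entry of `x` at or before the first place where `x` does, the
tie-breaking rule forces the two places to coincide. -/
theorem inBox_or_eq_of_precN {k : ℕ} {x y : Fin (k + 1) → ℕ} (h : precN (k + 1) y x) :
    InBox (firstMaxIndex x) (maxEntry x) y ∨ y (firstMaxIndex x) = maxEntry x := by
  have hM := h.maxEntry_le
  by_cases hb : ∀ m ≤ firstMaxIndex x, y m < maxEntry x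
  · exact Or.inl ⟨fun m => (le_maxEntry y m).trans hM, hb⟩
  right
  push Not at hb
  obtain ⟨m, hm, hy⟩ := hb
  have hMe : maxEntry y = maxEntry x := le_antisymm hM (hy.trans (le_maxEntry y m))
  have hm' := firstMaxIndex_le (le_antisymm (le_maxEntry y m) (hMe ▸ hy))
  rcases (precN_succ y x).1 h with h | ⟨-, h | ⟨h, -⟩⟩
  · omega
  · exact absurd (h.trans_le (hm'.trans hm)) (lt_irrefl _)
  · rw [← h, apply_firstMaxIndex y, hMe]

/-! ### Weights and the boundary of a lower set. -/

/-- The number of points of `ℕ^k` whose truncated coordinatewise predecessor is `u`. -/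
def cubeWeight {k : ℕ} (u : Fin k → ℕ) : ℕ :=
  ∏ i, if u i = 0 then 2 else 1

theorem cubeWeight_pos {k : ℕ} (u : Fin k → ℕ) : 1 ≤ cubeWeight u :=
  Nat.one_le_iff_ne_zero.2 (Finset.prod_ne_zero_iff.2 fun i _ => by split_ifs <;> norm_num)

theorem cubeWeight_insertNth {k : ℕ} (i : Fin (k + 1)) (t : ℕ) (u : Fin k → ℕ) :
    cubeWeight (i.insertNth t u : Fin (k + 1) → ℕ) = (if t = 0 then 2 else 1) * cubeWeight u := by
  simp [cubeWeight, Fin.prod_univ_succAbove _ i]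

theorem two_le_cubeWeight {k : ℕ} {u : Fin k → ℕ} {i : Fin k} (h : u i = 0) :
    2 ≤ cubeWeight u := by
  refine Nat.le_of_dvd (cubeWeight_pos u) ?_
  have := Finset.dvd_prod_of_mem (fun i => if u i = 0 then 2 else 1) (Finset.mem_univ i)
  rwa [if_pos h] at this

theorem cubeWeight_eq_one {k : ℕ} {u : Fin k → ℕ} (h : ∀ i, u i ≠ 0) : cubeWeight u = 1 :=
  Finset.prod_eq_one fun i _ => if_neg (h i)

theorem cubeWeight_le_two {k : ℕ} {u : Fin k → ℕ} {i : Fin k} (h : ∀ j, j ≠ i → u j ≠ 0) :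
    cubeWeight u ≤ 2 := by
  rw [cubeWeight, Finset.prod_eq_single i (fun j _ hj => if_neg (h j hj)) (by simp)]
  split_ifs <;> norm_num

/-- The vertex boundary of a finite set, as a finite set. -/
def finBoundary {k : ℕ} (A : Finset (Fin k → ℕ)) : Finset (Fin k → ℕ) :=
  A.biUnion fun a => Fintype.piFinset fun i => Finset.Icc (a i - 1) (a i + 1)

theorem mem_finBoundary {k : ℕ} {A : Finset (Fin k → ℕ)} {x : Fin k → ℕ} :
    x ∈ finBoundary A ↔ ∃ a ∈ A, ∀ i, a i ≤ x i + 1 ∧ x i ≤ a i + 1 := by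
  simp [finBoundary]

theorem coe_finBoundary {k : ℕ} (A : Finset (Fin k → ℕ)) :
    (finBoundary A : Set (Fin k → ℕ)) = vertexBoundary (A : Set (Fin k → ℕ)) := by
  ext x
  simp only [Finset.mem_coe, mem_finBoundary, vertexBoundary, Set.mem_ofPred_eq,
    dist_pi_le_iff zero_le_one, Nat.dist_eq, abs_le]
  refine exists_congr fun a => and_congr_right fun _ => forall_congr' fun i => ?_
  constructor
  · rintro ⟨h1, h2⟩
    have h1' : (a i : ℝ) ≤ x i + 1 := by exact_mod_cast h1
    have h2' : (x i : ℝ) ≤ a i + 1 := by exact_mod_cast h2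
    constructor <;> linarith
  · rintro ⟨h1, h2⟩
    have h1' : (a i : ℝ) ≤ x i + 1 := by linarith
    have h2' : (x i : ℝ) ≤ a i + 1 := by linarith
    exact ⟨by exact_mod_cast h1', by exact_mod_cast h2'⟩

/-- If `x` is within distance 1 of `a ∈ A`, its truncated predecessor is below `a`, hence in `A`.
The fibre of truncated predecessor over `u` is a product with two choices where `u i = 0` and one
elsewhere. -/
theorem card_finBoundary_le {k : ℕ} {A : Finset (Fin k → ℕ)}
    (hA : IsLowerSet (A : Set (Fin k → ℕ))) :
    (finBoundary A).card ≤ ∑ u ∈ A, cubeWeight u := by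
  have hsub : finBoundary A ⊆ A.biUnion fun u =>
      Fintype.piFinset fun i => if u i = 0 then {0, 1} else {u i + 1} := by
    intro x hx
    obtain ⟨a, ha, h⟩ := mem_finBoundary.1 hx
    refine Finset.mem_biUnion.2 ⟨fun i => x i - 1, hA (fun i => ?_) ha, ?_⟩
    · have := (h i).2
      simp only
      omega
    · rw [Fintype.mem_piFinset]
      intro i
      by_cases h0 : x i - 1 = 0
      · simp only [h0, if_true, Finset.mem_insert, Finset.mem_singleton]
        omega
      · simp only [h0, if_false, Finset.mem_singleton]
        omega
  refine (Finset.card_le_card hsub).trans (Finset.card_biUnion_le.trans (Finset.sum_le_sum ?_))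
  intro u _
  rw [Fintype.card_piFinset, cubeWeight]
  refine Finset.prod_le_prod' fun i _ => ?_
  split_ifs <;> simp

/-! ### Ranks and finite initial segments. -/

/-- The position of `v` in `≺_ℕ`. -/
noncomputable def precRank {k : ℕ} (v : Fin k → ℕ) : ℕ :=
  {u | precN k u v}.ncard

theorem precRank_lt {k : ℕ} {u v : Fin k → ℕ} (h : precN k u v) : precRank u < precRank v :=
  Set.ncard_lt_ncard ⟨fun w hw => precN_trans k w u v hw h, fun h' => precN_irrefl k u (h' h)⟩
    (finite_precN k v)

theorem precRank_lt_iff {k : ℕ} {u v : Fin k → ℕ} : precRank u < precRank v ↔ precN k u v := by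
  refine ⟨fun h => ?_, precRank_lt⟩
  rcases precN_trichotomous k u v with h1 | rfl | h1
  · exact h1
  · exact absurd h (lt_irrefl _)
  · exact absurd (precRank_lt h1) h.not_gt

theorem precRank_injective {k : ℕ} : Function.Injective (precRank (k := k)) := fun u v h => by
  rcases precN_trichotomous k u v with h1 | h1 | h1
  · exact absurd h (precRank_lt h1).ne
  · exact h1
  · exact absurd h (precRank_lt h1).ne'

theorem exists_precRank_eq {k : ℕ} {v : Fin k → ℕ} {m : ℕ} (h : m < precRank v) :
    ∃ u : Fin k → ℕ, precRank u = m := by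
  have hsub : (finite_precN k v).toFinset.image precRank ⊆ Finset.range (precRank v) := by
    intro r hr
    obtain ⟨u, hu, rfl⟩ := Finset.mem_image.1 hr
    exact Finset.mem_range.2 (precRank_lt (by simpa using hu))
  have heq := Finset.eq_of_subset_of_card_le hsub (by
    rw [Finset.card_range, Finset.card_image_of_injective _ precRank_injective, precRank,
      Set.ncard_eq_toFinset_card _ (finite_precN k v)])
  have hm := Finset.mem_range.2 h
  rw [← heq] at hm
  obtain ⟨u, -, hu⟩ := Finset.mem_image.1 hm
  exact ⟨u, hu⟩

/-- The first `n` points of `ℕ^k` in `≺_ℕ` (all of them, if there are fewer). -/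
noncomputable def initSeg (k n : ℕ) : Finset (Fin k → ℕ) :=
  ((Set.finite_Iio n).preimage precRank_injective.injOn).toFinset

theorem mem_initSeg {k n : ℕ} {v : Fin k → ℕ} : v ∈ initSeg k n ↔ precRank v < n := by
  simp [initSeg]

theorem card_initSeg_card {k : ℕ} (S : Finset (Fin k → ℕ)) :
    (initSeg k S.card).card = S.card := by
  apply le_antisymm
  · rw [← Finset.card_image_of_injective _ (precRank_injective (k := k))]
    calc _ ≤ (Finset.range S.card).card := Finset.card_le_card fun r hr => by
          obtain ⟨u, hu, rfl⟩ := Finset.mem_image.1 hr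
          exact Finset.mem_range.2 (mem_initSeg.1 hu)
      _ = _ := Finset.card_range _
  · by_cases h : S ⊆ initSeg k S.card
    · exact Finset.card_le_card h
    obtain ⟨v, -, hv⟩ := Finset.not_subset.1 h
    rw [mem_initSeg, not_lt] at hv
    rw [← Finset.card_image_of_injective (initSeg k S.card) precRank_injective]
    calc S.card = (Finset.range S.card).card := (Finset.card_range _).symm
      _ ≤ _ := Finset.card_le_card fun m hm => by
          rw [Finset.mem_range] at hm
          obtain ⟨u, rfl⟩ := exists_precRank_eq (hm.trans_le hv)
          exact Finset.mem_image.2 ⟨u, mem_initSeg.2 hm, rfl⟩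

theorem initSeg_mono {k m n : ℕ} (h : m ≤ n) : initSeg k m ⊆ initSeg k n := fun _ hv =>
  mem_initSeg.2 ((mem_initSeg.1 hv).trans_le h)

theorem isLowerSet_initSeg (k n : ℕ) : IsLowerSet (initSeg k n : Set (Fin k → ℕ)) := by
  intro v u huv hv
  rcases huv.eq_or_lt with rfl | h
  · exact hv
  · exact mem_initSeg.2 ((precRank_lt (precN_of_lt h)).trans (mem_initSeg.1 hv))

theorem precN_of_mem_initSeg {k n : ℕ} {u v : Fin k → ℕ} (hu : u ∈ initSeg k n)
    (hv : v ∉ initSeg k n) : precN k u v := by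
  rw [mem_initSeg] at hu hv
  exact precRank_lt_iff.1 (by omega)

theorem sum_lt_sum_of_card_eq {α : Type*} {s t : Finset α} {g : α → ℕ} (hc : s.card = t.card)
    (hs : s.Nonempty) (h : ∀ p ∈ s, ∀ q ∈ t, g p < g q) : ∑ p ∈ s, g p < ∑ q ∈ t, g q := by
  have e := Finset.equivOfCardEq hc
  rw [← Finset.sum_coe_sort s, ← Finset.sum_coe_sort t, ← e.sum_comp]
  have : Nonempty s := hs.to_subtype
  exact Finset.sum_lt_sum_of_nonempty Finset.univ_nonempty fun p _ => h p p.2 _ (e p).2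

theorem sum_initSeg_lt {k : ℕ} {S : Finset (Fin k → ℕ)} {g : (Fin k → ℕ) → ℕ}
    (hg : ∀ u v, precN k u v → g u < g v) (hS : S ≠ initSeg k S.card) :
    ∑ u ∈ initSeg k S.card, g u < ∑ u ∈ S, g u := by
  classical
  have hc := card_initSeg_card S
  rw [← Finset.sum_inter_add_sum_sdiff (initSeg k S.card) S,
    ← Finset.sum_inter_add_sum_sdiff S (initSeg k S.card), Finset.inter_comm]
  -- After cancelling the common part, every remaining point of the initial segment precedes every
  -- remaining point of `S`.
  refine Nat.add_lt_add_left (sum_lt_sum_of_card_eq (Finset.card_sdiff_comm hc) ?_ ?_) _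
  · rw [Finset.sdiff_nonempty]
    exact fun h => hS (Finset.eq_of_subset_of_card_le h hc.ge).symm
  · intro p hp q hq
    rw [Finset.mem_sdiff] at hp hq
    exact hg _ _ (precN_of_mem_initSeg hp.1 hq.2)

theorem eq_initSeg {k : ℕ} {I : Finset (Fin k → ℕ)}
    (hI : IsInitialSegmentN (I : Set (Fin k → ℕ))) : I = initSeg k I.card := by
  classical
  by_contra hne
  have hc := card_initSeg_card I
  obtain ⟨p, hp, hp'⟩ : ∃ p ∈ I, p ∉ initSeg k I.card := Finset.not_subset.1 fun h =>
    hne (Finset.eq_of_subset_of_card_le h hc.le)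
  obtain ⟨q, hq, hq'⟩ : ∃ q ∈ initSeg k I.card, q ∉ I := Finset.not_subset.1 fun h =>
    hne (Finset.eq_of_subset_of_card_le h hc.ge).symm
  exact hq' (hI q p hp (precN_of_mem_initSeg hq hp'))

/-! ### Slices and stacks. -/

/-- The slice of `A` on which the `i`-th coordinate is `t`. -/
def slice {k : ℕ} (i : Fin (k + 1)) (A : Finset (Fin (k + 1) → ℕ)) (t : ℕ) :
    Finset (Fin k → ℕ) :=
  (A.filter fun x => x i = t).image i.removeNth

theorem mem_slice {k : ℕ} {i : Fin (k + 1)} {A : Finset (Fin (k + 1) → ℕ)} {t : ℕ}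
    {u : Fin k → ℕ} : u ∈ slice i A t ↔ i.insertNth t u ∈ A := by
  simp only [slice, Finset.mem_image, Finset.mem_filter]
  constructor
  · rintro ⟨x, ⟨hx, rfl⟩, rfl⟩
    rwa [Fin.insertNth_self_removeNth]
  · intro h
    exact ⟨_, ⟨h, by simp⟩, by simp⟩

/-- The set whose first `N` slices in direction `i` are given by `S`. -/
def stack {k : ℕ} (i : Fin (k + 1)) (N : ℕ) (S : ℕ → Finset (Fin k → ℕ)) :
    Finset (Fin (k + 1) → ℕ) :=
  (Finset.range N).biUnion fun t => (S t).image (i.insertNth t)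

theorem mem_stack {k : ℕ} {i : Fin (k + 1)} {N : ℕ} {S : ℕ → Finset (Fin k → ℕ)}
    {x : Fin (k + 1) → ℕ} : x ∈ stack i N S ↔ x i < N ∧ i.removeNth x ∈ S (x i) := by
  simp only [stack, Finset.mem_biUnion, Finset.mem_range, Finset.mem_image]
  constructor
  · rintro ⟨t, ht, u, hu, rfl⟩
    simpa using ⟨ht, hu⟩
  · rintro ⟨h1, h2⟩
    exact ⟨x i, h1, _, h2, Fin.insertNth_self_removeNth _ _⟩

theorem sum_stack {k : ℕ} (i : Fin (k + 1)) (N : ℕ) (S : ℕ → Finset (Fin k → ℕ))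
    (g : (Fin (k + 1) → ℕ) → ℕ) :
    ∑ x ∈ stack i N S, g x = ∑ t ∈ Finset.range N, ∑ u ∈ S t, g (i.insertNth t u) := by
  rw [stack, Finset.sum_biUnion]
  · refine Finset.sum_congr rfl fun t _ => Finset.sum_image fun u _ v _ h => ?_
    simpa using congrArg i.removeNth h
  · intro s _ t _ hst
    refine Finset.disjoint_left.2 fun x hs ht => hst ?_
    obtain ⟨u, -, rfl⟩ := Finset.mem_image.1 hs
    obtain ⟨v, -, h⟩ := Finset.mem_image.1 ht
    simpa using (congrFun h i).symm

theorem card_stack {k : ℕ} (i : Fin (k + 1)) (N : ℕ) (S : ℕ → Finset (Fin k → ℕ)) :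
    (stack i N S).card = ∑ t ∈ Finset.range N, (S t).card := by
  simpa using sum_stack i N S fun _ => 1

theorem sum_cubeWeight_stack {k : ℕ} (i : Fin (k + 1)) (N : ℕ) (S : ℕ → Finset (Fin k → ℕ)) :
    ∑ x ∈ stack i N S, cubeWeight x =
      ∑ t ∈ Finset.range N, (if t = 0 then 2 else 1) * ∑ u ∈ S t, cubeWeight u := by
  simp_rw [sum_stack, cubeWeight_insertNth, Finset.mul_sum]

theorem stack_slice {k : ℕ} {i : Fin (k + 1)} {N : ℕ} {A : Finset (Fin (k + 1) → ℕ)}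
    (h : ∀ x ∈ A, x i < N) : stack i N (slice i A) = A := by
  ext x
  rw [mem_stack, mem_slice, Fin.insertNth_self_removeNth]
  exact ⟨fun hx => hx.2, fun hx => ⟨h x hx, hx⟩⟩

theorem isLowerSet_stack {k : ℕ} {i : Fin (k + 1)} {N : ℕ} {S : ℕ → Finset (Fin k → ℕ)}
    (hS : ∀ t, IsLowerSet (S t : Set (Fin k → ℕ))) (hanti : ∀ s t, s ≤ t → S t ⊆ S s) :
    IsLowerSet (stack i N S : Set (Fin (k + 1) → ℕ)) := by
  intro x y hyx hx
  rw [Finset.mem_coe, mem_stack] at hx ⊢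
  exact ⟨(hyx i).trans_lt hx.1, hanti _ _ (hyx i) (hS _ (fun j => hyx _) hx.2)⟩

theorem exists_forall_lt {k : ℕ} (i : Fin k) (A : Finset (Fin k → ℕ)) :
    ∃ N, ∀ x ∈ A, x i < N :=
  ⟨A.sup (fun x => x i) + 1, fun _ hx => Nat.lt_succ_of_le (Finset.le_sup (f := fun x => x i) hx)⟩

/-! ### Rank-minimal lower sets and exchanges. -/

/-- `A` is a lower set of least total rank among the lower sets of its size and no larger
weight. -/
structure IsRankMinimal {k : ℕ} (A : Finset (Fin k → ℕ)) : Prop where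
  isLowerSet : IsLowerSet (A : Set (Fin k → ℕ))
  le : ∀ A' : Finset (Fin k → ℕ), IsLowerSet (A' : Set (Fin k → ℕ)) → A'.card = A.card →
    ∑ u ∈ A', cubeWeight u ≤ ∑ u ∈ A, cubeWeight u → ∑ u ∈ A, precRank u ≤ ∑ u ∈ A', precRank u

theorem exists_isRankMinimal {k : ℕ} {A : Finset (Fin k → ℕ)}
    (hA : IsLowerSet (A : Set (Fin k → ℕ))) :
    ∃ A' : Finset (Fin k → ℕ), A'.card = A.card ∧
      ∑ u ∈ A', cubeWeight u ≤ ∑ u ∈ A, cubeWeight u ∧ IsRankMinimal A' := by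
  let C : Set (Finset (Fin k → ℕ)) := {A' | IsLowerSet (A' : Set (Fin k → ℕ)) ∧
    A'.card = A.card ∧ ∑ u ∈ A', cubeWeight u ≤ ∑ u ∈ A, cubeWeight u}
  have hC : C.Nonempty := ⟨A, hA, rfl, le_rfl⟩
  obtain ⟨h1, h2, h3⟩ := Function.argminOn_mem (fun A' => ∑ u ∈ A', precRank u) C hC
  refine ⟨_, h2, h3, h1, fun A' h1' h2' h3' => ?_⟩
  exact Function.argminOn_le (fun A' => ∑ u ∈ A', precRank u) C
    ⟨h1', h2'.trans h2, h3'.trans h3⟩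

/-- The slices of a rank-minimal set are initial segments, if initial segments are optimal one
dimension lower. -/
theorem IsRankMinimal.mem_of_precN {k : ℕ} {A : Finset (Fin (k + 1) → ℕ)} (hA : IsRankMinimal A)
    (ih : ∀ S : Finset (Fin k → ℕ), IsLowerSet (S : Set (Fin k → ℕ)) →
      ∑ u ∈ initSeg k S.card, cubeWeight u ≤ ∑ u ∈ S, cubeWeight u)
    {i : Fin (k + 1)} {u v : Fin (k + 1) → ℕ} (hv : v ∈ A) (huv : precN (k + 1) u v)
    (hi : u i = v i) : u ∈ A := by
  obtain ⟨N, hN⟩ := exists_forall_lt i A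
  have hlow : ∀ t, IsLowerSet (slice i A t : Set (Fin k → ℕ)) := by
    intro t a b hba ha
    rw [Finset.mem_coe, mem_slice] at ha ⊢
    exact hA.isLowerSet (Fin.insertNth_le_iff.2 (by simpa using hba)) ha
  have hanti : ∀ s t, s ≤ t → slice i A t ⊆ slice i A s := by
    intro s t hst a ha
    rw [mem_slice] at ha ⊢
    exact hA.isLowerSet (Fin.insertNth_le_iff.2 (by simpa using hst)) ha
  -- All slices are compressed at once; the result is a lower set because slice sizes decrease with
  -- `t`, so the new slices are nested.
  have hmin := hA.le (stack i N fun t => initSeg k (slice i A t).card)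
    (isLowerSet_stack (fun t => isLowerSet_initSeg _ _)
      fun s t hst => initSeg_mono (Finset.card_le_card (hanti s t hst)))
    (by
      conv_rhs => rw [← stack_slice hN]
      simp only [card_stack, card_initSeg_card])
    (by
      conv_rhs => rw [← stack_slice hN]
      simp only [sum_cubeWeight_stack]
      exact Finset.sum_le_sum fun t _ => Nat.mul_le_mul_left _ (ih _ (hlow t)))
  have hmono : ∀ t, ∀ a b : Fin k → ℕ, precN k a b →
      precRank (i.insertNth t a : Fin (k + 1) → ℕ) < precRank (i.insertNth t b : Fin (k + 1) → ℕ) :=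
    fun t a b h => precRank_lt ((precN_insertNth_iff i t a b).2 h)
  have hslice : slice i A (v i) = initSeg k (slice i A (v i)).card := by
    by_contra hne
    refine absurd hmin (not_le.2 ?_)
    conv_rhs => rw [← stack_slice hN]
    simp only [sum_stack]
    refine Finset.sum_lt_sum (fun t _ => ?_) ⟨v i, Finset.mem_range.2 (hN v hv), ?_⟩
    · by_cases h : slice i A t = initSeg k (slice i A t).card
      · rw [← h]
      · exact (sum_initSeg_lt (hmono t) h).le
    · exact sum_initSeg_lt (hmono _) hne
  have hv' : i.removeNth v ∈ slice i A (v i) := by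
    rwa [mem_slice, Fin.insertNth_self_removeNth]
  have hu' : i.removeNth u ∈ slice i A (v i) := by
    rw [hslice, mem_initSeg] at hv' ⊢
    exact (precRank_lt (huv.removeNth hi)).trans hv'
  rwa [← hi, mem_slice, Fin.insertNth_self_removeNth] at hu'

/-- The source of every contradiction below: trading `U` for equally many earlier points of no
larger weight would lower the total rank. -/
theorem IsRankMinimal.not_exchange {k : ℕ} {A U T : Finset (Fin k → ℕ)} (hA : IsRankMinimal A)
    (hU : U ⊆ A) (hU' : U.Nonempty) (hT : Disjoint A T) (hc : T.card = U.card)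
    (hw : ∑ u ∈ T, cubeWeight u ≤ ∑ u ∈ U, cubeWeight u)
    (hprec : ∀ p ∈ T, ∀ q ∈ U, precN k p q)
    (hlow : IsLowerSet ((A \ U ∪ T : Finset (Fin k → ℕ)) : Set (Fin k → ℕ))) : False := by
  have hdisj : Disjoint (A \ U) T := hT.mono_left Finset.sdiff_subset
  have hlt : ∑ u ∈ T, precRank u < ∑ u ∈ U, precRank u :=
    sum_lt_sum_of_card_eq hc (Finset.card_pos.1 (hc ▸ hU'.card_pos))
      fun p hp q hq => precRank_lt (hprec p hp q hq)
  have h := hA.le _ hlow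
    (by rw [Finset.card_union_of_disjoint hdisj, hc, Finset.card_sdiff_add_card_eq_card hU])
    (by
      rw [Finset.sum_union hdisj, ← Finset.sum_sdiff hU]
      exact Nat.add_le_add_left hw _)
  rw [Finset.sum_union hdisj, ← Finset.sum_sdiff hU] at h
  omega

/-- A lower set can be extended inside a larger lower set by any admissible number of points. -/
theorem exists_subset_isLowerSet_union {k : ℕ} {A D : Finset (Fin k → ℕ)}
    (hA : IsLowerSet (A : Set (Fin k → ℕ)))
    (hAD : IsLowerSet ((A ∪ D : Finset (Fin k → ℕ)) : Set (Fin k → ℕ))) :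
    ∀ s ≤ D.card, ∃ T ⊆ D, T.card = s ∧
      IsLowerSet ((A ∪ T : Finset (Fin k → ℕ)) : Set (Fin k → ℕ))
  | 0, _ => ⟨∅, Finset.empty_subset _, rfl, by simpa using hA⟩
  | s + 1, hs => by
    obtain ⟨T, hTD, hTs, hT⟩ := exists_subset_isLowerSet_union hA hAD s (by omega)
    have hne : (D \ T).Nonempty := by
      rw [← Finset.card_pos, Finset.card_sdiff_of_subset hTD]
      omega
    -- Minimality keeps the set lower: anything in `D` strictly below `m` has been added already.
    obtain ⟨m, hm⟩ := (D \ T).exists_minimal hne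
    have hmD := Finset.mem_sdiff.1 hm.1
    refine ⟨insert m T, Finset.insert_subset hmD.1 hTD, ?_, ?_⟩
    · rw [Finset.card_insert_of_notMem hmD.2, hTs]
    intro a b hba ha
    simp only [Finset.coe_union, Finset.coe_insert, Set.mem_union, Set.mem_insert_iff,
      Finset.mem_coe] at ha ⊢
    have key : a ∈ A ∪ T → b ∈ A ∨ b = m ∨ b ∈ T := fun h => by
      have := hT hba h
      simp only [Finset.coe_union, Set.mem_union, Finset.mem_coe] at this
      tauto
    rcases ha with ha | rfl | ha
    · exact key (Finset.mem_union_left _ ha)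
    · have := hAD hba (Finset.mem_coe.2 (Finset.mem_union_right _ hmD.1))
      simp only [Finset.coe_union, Set.mem_union, Finset.mem_coe] at this
      rcases this with h | h
      · exact Or.inl h
      by_cases hbT : b ∈ T
      · exact Or.inr (Or.inr hbT)
      · exact Or.inr (Or.inl (le_antisymm hba (hm.2 (Finset.mem_sdiff.2 ⟨h, hbT⟩) hba)))
    · exact key (Finset.mem_union_right _ ha)

theorem isLowerSet_sdiff_union {k : ℕ} {A U T : Finset (Fin k → ℕ)}
    (hT : IsLowerSet ((A ∪ T : Finset (Fin k → ℕ)) : Set (Fin k → ℕ)))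
    (hUA : ∀ u ∈ U, ∀ v ∈ A, u ≤ v → v ∈ U) (hUT : ∀ u ∈ U, ∀ v ∈ T, ¬ u ≤ v) :
    IsLowerSet ((A \ U ∪ T : Finset (Fin k → ℕ)) : Set (Fin k → ℕ)) := by
  intro a b hba ha
  have hb : b ∈ A ∪ T := hT hba (Finset.union_subset_union_left Finset.sdiff_subset ha)
  simp only [Finset.mem_coe, Finset.mem_union, Finset.mem_sdiff] at ha hb ⊢
  rcases hb with hb | hb
  · by_cases hbU : b ∈ U
    · rcases ha with ha | ha
      · exact absurd (hUA b hbU a ha.1 hba) ha.2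
      · exact absurd hba (hUT b hbU a ha)
    · exact Or.inl ⟨hb, hbU⟩
  · exact Or.inr hb

theorem update_le_update {k : ℕ} {u v : Fin k → ℕ} (h : u ≤ v) (i : Fin k) (t : ℕ) :
    Function.update u i t ≤ Function.update v i t :=
  update_le_update_iff.2 ⟨le_rfl, fun j _ => h j⟩

theorem update_zero_le {k : ℕ} (u : Fin k → ℕ) (i : Fin k) : Function.update u i 0 ≤ u :=
  update_le_iff.2 ⟨Nat.zero_le _, fun _ _ => le_rfl⟩

/-- Any segment above a maximal point of the section `v j = 0` is a line. -/
theorem card_filter_le_of_maximal {k : ℕ} {A : Finset (Fin k → ℕ)} {w : Fin k → ℕ} {j : Fin k}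
    {M : ℕ} [DecidablePred fun v => w ≤ v] (hA : IsLowerSet (A : Set (Fin k → ℕ))) (hwj : w j = 0)
    (hw : ∀ v ∈ A, v j = 0 → w ≤ v → v = w) (hM : ∀ v ∈ A, w ≤ v → v j < M) :
    (A.filter fun v => w ≤ v).card ≤ M := by
  have hinj : Set.InjOn (fun v : Fin k → ℕ => v j) (A.filter fun v => w ≤ v) := by
    have key : ∀ v ∈ A.filter fun v => w ≤ v, v = Function.update w j (v j) := by
      intro v hv
      rw [Finset.mem_filter] at hv
      have h := hw (Function.update v j 0) (hA (update_zero_le v j) hv.1) (by simp)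
        (le_update_iff.2 ⟨hwj.le, fun m _ => hv.2 m⟩)
      rw [← h, Function.update_idem, Function.update_eq_self]
    intro a ha b hb hab
    rw [key a ha, key b hb, show a j = b j from hab]
  calc _ ≤ (Finset.range M).card := Finset.card_le_card_of_injOn _ (fun v hv => ?_) hinj
    _ = M := Finset.card_range M
  have hv := Finset.mem_filter.1 hv
  simpa using hM v hv.1 hv.2

/-- Compare the last point `x` of `A` with the first missing point `y`. If `y` weighs no more than
`x`, swap them. Otherwise `y` has weight 2, with its only zero at `i`, and a line of `A` in the face
`v i = M` is traded for missing points of the box, at most one of which has weight 2. -/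
theorem IsRankMinimal.isInitialSegmentN {k : ℕ} {A : Finset (Fin (k + 1) → ℕ)}
    (hA : IsRankMinimal A)
    (ih : ∀ S : Finset (Fin k → ℕ), IsLowerSet (S : Set (Fin k → ℕ)) →
      ∑ u ∈ initSeg k S.card, cubeWeight u ≤ ∑ u ∈ S, cubeWeight u) :
    IsInitialSegmentN (A : Set (Fin (k + 1) → ℕ)) := by
  intro y₀ x₀ hx₀ hyx₀
  by_contra hy₀
  classical
  obtain ⟨x, hxA, hxmax⟩ := A.exists_max_image precRank ⟨x₀, hx₀⟩
  obtain ⟨y, hyA, hymin⟩ := (measure (precRank (k := k + 1))).wf.has_min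
    {y | y ∉ A} ⟨y₀, hy₀⟩
  replace hymin : ∀ z, precN (k + 1) z y → z ∈ A := fun z hz => by
    by_contra hzA
    exact hymin z hzA (precRank_lt hz)
  replace hyA : y ∉ A := hyA
  have hyx : precN (k + 1) y x := by
    rw [← precRank_lt_iff]
    refine lt_of_le_of_lt ?_ ((precRank_lt hyx₀).trans_le (hxmax _ hx₀))
    exact not_lt.1 fun h => hy₀ (hymin _ (precRank_lt_iff.1 h))
  have hcomp := fun {i u v} => hA.mem_of_precN ih (i := i) (u := u) (v := v)
  set i := firstMaxIndex x
  set M := maxEntry x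
  have hxi : x i = M := apply_firstMaxIndex x
  have hyB : InBox i M y := by
    rcases inBox_or_eq_of_precN hyx with h | h
    · exact h
    · exact absurd (hcomp hxA hyx (h.trans hxi.symm)) hyA
  -- missing points of the box exceed `x` off the `i`-th coordinate
  have hD : ∀ w, InBox i M w → w ∉ A → ∀ j, j ≠ i → x j < w j := by
    intro w hwB hwA j hj
    by_contra hle
    -- Raising `w j` to `x j` stays in the box and gives a point before `x` sharing its `j`-th
    -- entry, so compressed slices put it, and hence `w`, in `A`.
    have hzB : InBox i M (Function.update w j (x j)) := by
      constructor
      · intro m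
        by_cases hm : m = j
        · subst hm
          simpa using le_maxEntry x m
        · simpa [hm] using hwB.1 m
      · intro m hmi
        by_cases hm : m = j
        · subst hm
          rw [Function.update_self]
          refine lt_of_le_of_ne (le_maxEntry x m) fun h => hj ?_
          exact le_antisymm hmi (firstMaxIndex_le h)
        · simpa [hm] using hwB.2 m hmi
    have hzA := hcomp hxA (hzB.precN hxi.ge) (i := j) (by simp)
    exact hwA (hA.isLowerSet (le_update_iff.2 ⟨not_lt.1 hle, fun m _ => le_rfl⟩) hzA)
  have hlowy : ∀ z, z ≤ y → z ∈ A ∨ z = y := fun z hz => by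
    rcases hz.eq_or_lt with h | h
    · exact Or.inr h
    · exact Or.inl (hymin z (precN_of_lt h))
  by_cases hwt : cubeWeight y ≤ cubeWeight x
  · refine hA.not_exchange (U := {x}) (T := {y}) (by simpa using hxA) (by simp) (by simpa using hyA)
      (by simp) (by simpa using hwt) (by simpa using hyx) (isLowerSet_sdiff_union ?_ ?_ ?_)
    · intro a b hba ha
      simp only [Finset.mem_coe, Finset.mem_union, Finset.mem_singleton] at ha ⊢
      rcases ha with ha | rfl
      · exact Or.inl (hA.isLowerSet hba ha)
      · exact hlowy b hba
    · intro u hu v hv huv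
      rw [Finset.mem_singleton] at hu ⊢
      subst hu
      rcases huv.eq_or_lt with h | h
      · exact h.symm
      · exact absurd (hxmax v hv) (not_le.2 (precRank_lt (precN_of_lt h)))
    · intro u hu v hv huv
      rw [Finset.mem_singleton] at hu hv
      subst hu hv
      rcases huv.eq_or_lt with h | h
      · exact hyA (h ▸ hxA)
      · exact precN_irrefl _ _ (precN_trans _ _ _ _ hyx (precN_of_lt h))
  have hy0 : ∀ j, j ≠ i → y j ≠ 0 := fun j hj => ((Nat.zero_le _).trans_lt (hD y hyB hyA j hj)).ne'
  have hyi : y i = 0 := by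
    by_contra h
    refine hwt ((cubeWeight_eq_one fun j => ?_).trans_le (cubeWeight_pos x))
    by_cases hj : j = i
    · exact hj ▸ h
    · exact hy0 j hj
  obtain ⟨j, hj⟩ : ∃ j, j ≠ i := by
    by_contra! h
    refine hyA (hA.isLowerSet (fun m => ?_) hxA)
    rw [h m, hyi]
    exact Nat.zero_le _
  have hAM : ∀ v ∈ A, ∀ m, v m ≤ M := by
    intro v hv m
    refine (le_maxEntry v m).trans ?_
    rcases precN_trichotomous _ v x with h | rfl | h
    · exact h.maxEntry_le
    · exact le_rfl
    · exact absurd (hxmax v hv) (not_le.2 (precRank_lt h))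
  have hface : ∀ v ∈ A, v i = M → v j < M := by
    intro v hv hvi
    -- Off `i` the entries of `x` are below those of `y`, hence below `M`. As `v` does not come
    -- after `x`, deleting entry `i` passes this bound on to `v`.
    have hxlt : ∀ m, m ≠ i → x m < M := fun m hm => (hD y hyB hyA m hm).trans_le (hyB.1 m)
    rcases precN_trichotomous _ v x with h | rfl | h
    · have h' := h.removeNth (i := i) (hvi.trans hxi.symm)
      obtain ⟨p, rfl⟩ := Fin.exists_succAbove_eq hj
      cases k with
      | zero => exact p.elim0
      | succ k =>
        refine ((le_maxEntry (i.removeNth v) p).trans h'.maxEntry_le).trans_lt ?_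
        rw [← apply_firstMaxIndex (i.removeNth x)]
        exact hxlt _ (Fin.succAbove_ne _ _)
    · exact hxlt j hj
    · exact absurd (hxmax v hv) (not_le.2 (precRank_lt h))
  -- the line to be removed
  obtain ⟨w, hw⟩ := (A.filter fun v => v i = M ∧ v j = 0).exists_maximal
    ⟨Function.update x j 0, by
      simpa [hj.symm, hxi] using hA.isLowerSet (update_zero_le x j) hxA⟩
  obtain ⟨hwA, hwi, hwj⟩ := Finset.mem_filter.1 hw.1
  have habove : ∀ v ∈ A, w ≤ v → v i = M := fun v hv h =>
    le_antisymm (hAM v hv i) (hwi.ge.trans (h i))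
  set U := A.filter fun v => w ≤ v
  have hUcard : U.card ≤ M := by
    refine card_filter_le_of_maximal (j := j) hA.isLowerSet hwj ?_ ?_
    · intro v hv hvj hwv
      exact le_antisymm (hw.2 (Finset.mem_filter.2 ⟨hv, habove v hv hwv, hvj⟩) hwv) hwv
    · intro v hv hwv
      exact hface v hv (habove v hv hwv)
  have hwU : w ∈ U := Finset.mem_filter.2 ⟨hwA, le_rfl⟩
  have hUwt : U.card + 1 ≤ ∑ u ∈ U, cubeWeight u := by
    rw [← Finset.add_sum_erase _ _ hwU, ← Finset.card_erase_add_one hwU]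
    have h1 : (U.erase w).card ≤ ∑ u ∈ U.erase w, cubeWeight u := by
      simpa using Finset.card_nsmul_le_sum (U.erase w) cubeWeight 1 fun u _ => cubeWeight_pos u
    have h2 := two_le_cubeWeight hwj
    omega
  -- the points to be added
  let D := (Fintype.piFinset fun _ : Fin (k + 1) => Finset.range (M + 1)).filter fun v =>
    InBox i M v ∧ v ∉ A ∧ (Function.update v i 0 ∈ A ∨ Function.update v i 0 = y)
  have memD : ∀ v, v ∈ D ↔
      InBox i M v ∧ v ∉ A ∧ (Function.update v i 0 ∈ A ∨ Function.update v i 0 = y) := by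
    intro v
    simp only [D, Finset.mem_filter, Fintype.mem_piFinset, Finset.mem_range, Nat.lt_succ_iff]
    exact ⟨fun h => h.2, fun h => ⟨h.1.1, h⟩⟩
  have hupy : Function.update y i 0 = y := by rw [← hyi, Function.update_eq_self]
  have hDcard : M ≤ D.card := by
    calc M = (Finset.range M).card := (Finset.card_range M).symm
      -- The column through `y` in direction `i`, at heights `0, …, M - 1`, already supplies enough
      -- points.
      _ ≤ D.card := Finset.card_le_card_of_injOn (fun t => Function.update y i t) ?_ ?_
    · intro t ht
      have ht : t < M := by simpa using ht
      refine (memD _).2 ⟨⟨fun m => ?_, fun m hm => ?_⟩, fun h => hyA (hA.isLowerSet ?_ h), ?_⟩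
      · by_cases h : m = i
        · subst h; simpa using ht.le
        · simpa [h] using hyB.1 m
      · by_cases h : m = i
        · subst h; simpa using ht
        · simpa [h] using hyB.2 m hm
      · exact le_update_iff.2 ⟨by rw [hyi]; exact Nat.zero_le _, fun m _ => le_rfl⟩
      · exact Or.inr (by rw [Function.update_idem, hupy])
    · intro s _ t _ h
      simpa using congrFun h i
  have hAD : IsLowerSet ((A ∪ D : Finset (Fin (k + 1) → ℕ)) : Set (Fin (k + 1) → ℕ)) := by
    intro a b hba ha
    simp only [Finset.mem_coe, Finset.mem_union] at ha ⊢
    by_cases hb : b ∈ A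
    · exact Or.inl hb
    rcases ha with ha | ha
    · exact Or.inl (hA.isLowerSet hba ha)
    obtain ⟨haB, -, ha⟩ := (memD a).1 ha
    refine Or.inr ((memD b).2 ⟨haB.mono hba, hb, ?_⟩)
    have hle := update_le_update hba i 0
    rcases ha with ha | ha
    · exact Or.inl (hA.isLowerSet hle ha)
    · exact hlowy _ (ha ▸ hle)
  obtain ⟨T, hTD, hTcard, hT⟩ :=
    exists_subset_isLowerSet_union hA.isLowerSet hAD U.card (hUcard.trans hDcard)
  have hTwt : ∑ u ∈ T, cubeWeight u ≤ U.card + 1 := by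
    -- A point of `D` with entry `0` at `i` is its own projection, so being outside `A` it must be
    -- `y`.
    have h1 : ∀ v ∈ T, v ≠ y → cubeWeight v = 1 := by
      intro v hv hvy
      obtain ⟨hvB, hvA, hv0⟩ := (memD v).1 (hTD hv)
      refine cubeWeight_eq_one fun m => ?_
      by_cases hm : m = i
      · subst hm
        intro h
        rw [← h, Function.update_eq_self] at hv0
        tauto
      · exact ((Nat.zero_le _).trans_lt (hD v hvB hvA m hm)).ne'
    calc ∑ u ∈ T, cubeWeight u ≤ ∑ u ∈ T, (1 + if u = y then 1 else 0) := by
          refine Finset.sum_le_sum fun v hv => ?_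
          split_ifs with h
          · exact h ▸ cubeWeight_le_two hy0
          · exact (h1 v hv h).le
      _ ≤ U.card + 1 := by
          rw [Finset.sum_add_distrib, Finset.sum_ite_eq', ← hTcard]
          simp only [Finset.sum_const, smul_eq_mul, mul_one]
          split_ifs <;> omega
  refine hA.not_exchange (Finset.filter_subset _ _) ⟨w, hwU⟩ ?_ hTcard (hTwt.trans hUwt) ?_
    (isLowerSet_sdiff_union hT ?_ ?_)
  · exact Finset.disjoint_right.2 fun v hv => ((memD v).1 (hTD hv)).2.1
  · intro p hp q hq
    obtain ⟨hqA, hwq⟩ := Finset.mem_filter.1 hq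
    exact ((memD p).1 (hTD hp)).1.precN (habove q hqA hwq).ge
  · intro u hu v hv huv
    exact Finset.mem_filter.2 ⟨hv, (Finset.mem_filter.1 hu).2.trans huv⟩
  · intro u hu v hv huv
    have h1 := ((memD v).1 (hTD hv)).1.2 i le_rfl
    have h2 : w i ≤ v i := ((Finset.mem_filter.1 hu).2.trans huv) i
    omega

/-- Initial segments have least weight among lower sets. -/
theorem sum_cubeWeight_initSeg_le : ∀ {k : ℕ} (A : Finset (Fin k → ℕ)),
    IsLowerSet (A : Set (Fin k → ℕ)) →
      ∑ u ∈ initSeg k A.card, cubeWeight u ≤ ∑ u ∈ A, cubeWeight u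
  | 0, A, _ => by
    rw [← eq_initSeg (I := A) fun _ _ _ h => h.elim]
  | k + 1, A, hA => by
    obtain ⟨A', hc, hw, hA'⟩ := exists_isRankMinimal hA
    rw [← hc, ← eq_initSeg (hA'.isInitialSegmentN sum_cubeWeight_initSeg_le)]
    exact hw

/-! ### Arbitrary finite sets. -/

theorem finBoundary_slice_subset {k : ℕ} (i : Fin (k + 1)) (A : Finset (Fin (k + 1) → ℕ))
    {s t : ℕ} (hst : s ≤ t + 1) (hts : t ≤ s + 1) :
    finBoundary (slice i A s) ⊆ slice i (finBoundary A) t := by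
  intro u hu
  obtain ⟨a, ha, h⟩ := mem_finBoundary.1 hu
  rw [mem_slice, mem_finBoundary]
  refine ⟨_, mem_slice.1 ha, fun j => ?_⟩
  rcases Fin.eq_self_or_eq_succAbove i j with rfl | ⟨p, rfl⟩
  · simpa using ⟨hst, hts⟩
  · simpa using h p

/-- Bound `c t` below by `f t` for `t ≤ T` and by `f (t - 1)` for `t > T`: the index `T` is used
twice, every other one once. -/
theorem sum_range_add_le {N T : ℕ} (hT : T < N) {f c : ℕ → ℕ} (h0 : ∀ t, f t ≤ c t)
    (h1 : ∀ t, f t ≤ c (t + 1)) :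
    ∑ t ∈ Finset.range N, f t + f T ≤ ∑ t ∈ Finset.range (N + 1), c t := by
  obtain ⟨d, rfl⟩ := Nat.exists_eq_add_of_lt hT
  have e1 : ∑ t ∈ Finset.range (T + d + 1), f t =
      ∑ t ∈ Finset.range T, f t + ∑ t ∈ Finset.range (d + 1), f (T + t) := by
    rw [add_assoc, Finset.sum_range_add]
  have e2 : ∑ t ∈ Finset.range (T + d + 1 + 1), c t = ∑ t ∈ Finset.range (T + 1), c t +
      ∑ t ∈ Finset.range (d + 1), c (T + t + 1) := by
    rw [show T + d + 1 + 1 = (T + 1) + (d + 1) by ring, Finset.sum_range_add]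
    simp only [add_right_comm T 1]
  rw [e1, e2, Finset.sum_range_succ c T]
  have h2 : ∑ t ∈ Finset.range T, f t ≤ ∑ t ∈ Finset.range T, c t :=
    Finset.sum_le_sum fun t _ => h0 t
  have h3 : ∑ t ∈ Finset.range (d + 1), f (T + t) ≤ ∑ t ∈ Finset.range (d + 1), c (T + t + 1) :=
    Finset.sum_le_sum fun t _ => h1 _
  have := h0 T
  omega

/-- Rearranging the first `N` values of a sequence in decreasing order. -/
theorem exists_antitone_rearrangement (N : ℕ) (a : ℕ → ℕ) :
    ∃ b : ℕ → ℕ, Antitone b ∧ (∀ t < N, ∃ s < N, b t = a s) ∧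
      ∀ φ : ℕ → ℕ, ∑ t ∈ Finset.range N, φ (b t) = ∑ t ∈ Finset.range N, φ (a t) := by
  let f : Fin N → ℕᵒᵈ := fun t => OrderDual.toDual (a t)
  have hs := Tuple.monotone_sort f
  let σ := Tuple.sort f
  refine ⟨fun t => if h : t < N then a (σ ⟨t, h⟩) else 0, ?_, ?_, ?_⟩
  · intro s t hst
    by_cases ht : t < N
    · have hs' : s < N := hst.trans_lt ht
      simp only [ht, hs', dif_pos]
      exact OrderDual.toDual_le_toDual.1 (hs (show (⟨s, hs'⟩ : Fin N) ≤ ⟨t, ht⟩ from hst))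
    · simp [ht]
  · intro t ht
    exact ⟨_, (σ ⟨t, ht⟩).2, by simp [ht]⟩
  · intro φ
    rw [← Fin.sum_univ_eq_sum_range (fun t => φ (a t)), ← Equiv.sum_comp σ,
      ← Fin.sum_univ_eq_sum_range (fun t => φ (if h : t < N then a (σ ⟨t, h⟩) else 0))]
    simp

/-- Initial segments minimise the vertex boundary. -/
theorem sum_cubeWeight_initSeg_le_card_finBoundary : ∀ {k : ℕ} (A : Finset (Fin k → ℕ)),
    ∑ u ∈ initSeg k A.card, cubeWeight u ≤ (finBoundary A).card
  | 0, A => by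
    rw [← eq_initSeg (I := A) fun _ _ _ h => h.elim]
    simp only [cubeWeight, Finset.univ_eq_empty, Finset.prod_empty, Finset.sum_const, smul_eq_mul,
      mul_one]
    exact Finset.card_le_card fun a ha => mem_finBoundary.2 ⟨a, ha, fun i => i.elim0⟩
  | k + 1, A => by
    have ih := fun S : Finset (Fin k → ℕ) => sum_cubeWeight_initSeg_le_card_finBoundary S
    obtain ⟨N, hN⟩ := exists_forall_lt 0 A
    rcases A.eq_empty_or_nonempty with rfl | ⟨x, hx⟩
    · rw [← eq_initSeg fun _ _ hv => absurd hv (Finset.notMem_empty _), Finset.sum_empty]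
      exact Nat.zero_le _
    have hNpos : 0 < N := (Nat.zero_le _).trans_lt (hN x hx)
    let a : ℕ → ℕ := fun t => (slice 0 A t).card
    let F : ℕ → ℕ := fun n => ∑ u ∈ initSeg k n, cubeWeight u
    obtain ⟨b, hb, hba, hsum⟩ := exists_antitone_rearrangement N a
    let A' := stack 0 N fun t => initSeg k (b t)
    have hbcard : ∀ t < N, (initSeg k (b t)).card = b t := by
      intro t ht
      obtain ⟨s, -, hs⟩ := hba t ht
      rw [hs]
      exact card_initSeg_card _
    have hcard : A'.card = A.card := by
      calc A'.card = ∑ t ∈ Finset.range N, b t := by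
            rw [card_stack]
            exact Finset.sum_congr rfl fun t ht => hbcard t (Finset.mem_range.1 ht)
        _ = ∑ t ∈ Finset.range N, a t := hsum id
        _ = A.card := by rw [← card_stack, stack_slice hN]
    have hlow : IsLowerSet (A' : Set (Fin (k + 1) → ℕ)) :=
      isLowerSet_stack (fun t => isLowerSet_initSeg _ _) fun s t hst => initSeg_mono (hb hst)
    -- The bottom slice counts twice, and after sorting it is a largest one.
    have hW : ∑ u ∈ A', cubeWeight u = ∑ t ∈ Finset.range N, F (a t) + F (b 0) := by
      rw [sum_cubeWeight_stack, ← hsum F]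
      obtain ⟨n, rfl⟩ := Nat.exists_eq_add_of_lt hNpos
      simp only [zero_add, Finset.sum_range_succ', F]
      simp
      ring
    have hbound : ∀ x ∈ finBoundary A, x 0 < N + 1 := by
      intro x hx
      obtain ⟨y, hy, h⟩ := mem_finBoundary.1 hx
      have h1 := hN y hy
      have h2 := (h 0).2
      omega
    -- `T` is the position of a largest slice of `A`, where the boundary gains its extra copy.
    obtain ⟨T, hT, hbT⟩ := hba 0 hNpos
    calc ∑ u ∈ initSeg (k + 1) A.card, cubeWeight u ≤ ∑ u ∈ A', cubeWeight u :=
          hcard ▸ sum_cubeWeight_initSeg_le A' hlow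
      _ = ∑ t ∈ Finset.range N, F (a t) + F (a T) := by rw [hW, hbT]
      _ ≤ ∑ t ∈ Finset.range (N + 1), (slice 0 (finBoundary A) t).card :=
          sum_range_add_le hT (f := fun t => F (a t))
            (fun t => (ih (slice 0 A t)).trans
              (Finset.card_le_card (finBoundary_slice_subset 0 A (by omega) (by omega))))
            (fun t => (ih (slice 0 A t)).trans
              (Finset.card_le_card (finBoundary_slice_subset 0 A (by omega) (by omega))))
      _ = (finBoundary A).card := by rw [← card_stack, stack_slice hbound]

theorem mainTheorem2 (k : ℕ) (hk : 1 ≤ k) (I A : Set (Fin k → ℕ))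
    (hI : IsInitialSegmentN I) (hA : A.Finite) (hA' : A.Nonempty)
    (hcard : I.encard = A.encard) :
    (vertexBoundary I).encard ≤ (vertexBoundary A).encard := by
  have hIfin : I.Finite := by
    rw [← Set.encard_lt_top_iff, hcard]
    exact hA.encard_lt_top
  lift I to Finset (Fin k → ℕ) using hIfin
  lift A to Finset (Fin k → ℕ) using hA
  rw [Set.encard_coe_eq_coe_finsetCard, Set.encard_coe_eq_coe_finsetCard, Nat.cast_inj] at hcard
  rw [← coe_finBoundary, ← coe_finBoundary, Set.encard_coe_eq_coe_finsetCard,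
    Set.encard_coe_eq_coe_finsetCard, Nat.cast_le]
  have hIeq := eq_initSeg hI
  have hlow : IsLowerSet (I : Set (Fin k → ℕ)) := by
    rw [hIeq]
    exact isLowerSet_initSeg _ _
  refine (card_finBoundary_le hlow).trans ?_
  rw [hIeq, hcard]
  exact sum_cubeWeight_initSeg_le_card_finBoundary A
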